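/- Setting. An MPMAB instance with $K\ge 1$ arms and $M\ge 1$ players consists of probability distributions $\mathcal D_i^p$ on $[0,1]$ with means $\mu_i^p$, one for each arm $i\in[K]$ and each player $p\in[M]$; it is a Bernoulli instance if every $\mathcal D_i^p$ is a Bernoulli distribution. A multi-player algorithm with horizon $T\ge 1$ is a sequence of conditional probability distributions $\pi_1,\dots,\pi_T$, where $\pi_t$ is the distribution of the joint action $(i_t^p)_{p\in[M]}\in[K]^M$ in round $t$ given the arms pulled and the rewards received by all players in the rounds before $t$; given the joint action in round $t$, the rewards $r_t^p\sim\mathcal D^p_{i_t^p}$, $p\in[M]$, are drawn independently of each other and of the past. Let $\Delta_i^p=\max_{j\in[K]}\mu_j^p-\mu_i^p$, let $n_i^p(T)$ be the number of rounds $t\in[T]$ with $i_t^p=i$, and let $\mathbb E[\mathcal R(T)]=\sum_{p\in[M]}\sum_{i\in[K]}\Delta_i^p\,\mathbb E[n_i^p(T)]$ be the expected collective regret. Theorem. Let $C>0$ and $\alpha>0$, and let $\mathcal A$ be an algorithm with horizon $T$ for $K$ arms and $M$ players such that $\mathbb E[\mathcal R(T)]\le C\,T^{1-\alpha}$ on every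 MPMAB instance with $K$ arms and $M$ players. Then, on every Bernoulli MPMAB instance $\mu=(\mu_i^p)_{i\in[K],p\in[M]}$ with $\mu_i^p\in\left[\tfrac{15}{32},\tfrac{17}{32}\right]$ for all $i\in[K]$ and $p\in[M]$, the expected collective regret of $\mathcal A$ satisfies $$\mathbb E_\mu[\mathcal R(T)]\;\ge\;\sum_{i\in[K]}\ \sum_{p\in[M]:\,\Delta_i^p>0}\frac{\ln\!\left(T^{\alpha}\Delta_i^p/(8C)\right)}{12\,\Delta_i^p}.$$ -/

import Mathlib

open MeasureTheory ProbabilityTheory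
open scoped unitInterval

namespace MPMAB

/-- An MPMAB problem instance with `K` arms and `M` players: for every arm `i` and player `p` a
reward distribution `ν i p`, i.e. a probability measure on `[0, 1]`. -/
abbrev Instance (K M : ℕ) : Type := Fin K → Fin M → ProbabilityMeasure I

/-- The outcome of one round: the arm pulled by every player, and the reward of every player. -/
abbrev Round (K M : ℕ) : Type := (Fin M → Fin K) × (Fin M → I)

/-- The history of the first `t` rounds: all arms pulled and all rewards received. -/
abbrev History (K M t : ℕ) : Type := Fin t → Round K M

/-- A multi-player bandit algorithm with horizon `T`: for every round a conditional probability
distribution of the joint action of all players, given the history of the earlier rounds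
(rounds are numbered `0, …, T - 1`, so that `t` rounds precede round `t`). -/
structure Algorithm (K M T : ℕ) where
  /-- The policy used in round `t`. -/
  policy : (t : ℕ) → t < T → Kernel (History K M t) (Fin M → Fin K)
  /-- Every policy consists of probability distributions. -/
  markov : ∀ t (ht : t < T), IsMarkovKernel (policy t ht)

attribute [instance] Algorithm.markov

section Instance

variable {K M : ℕ}

/-- The mean reward of arm `i` for player `p`. -/
noncomputable def mean (ν : Instance K M) (i : Fin K) (p : Fin M) : ℝ :=
  ∫ x : I, (x : ℝ) ∂(ν i p : Measure I)

/-- The suboptimality gap of arm `i` for player `p`: the largest mean reward over all arms for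
player `p`, minus the mean reward of arm `i`. -/
noncomputable def gap (ν : Instance K M) (i : Fin K) (p : Fin M) : ℝ :=
  (⨆ j : Fin K, mean ν j p) - mean ν i p

/-- All reward distributions are Bernoulli distributions (on the values `1` and `0`). -/
def IsBernoulli (ν : Instance K M) : Prop :=
  ∀ i p, ∃ q : I, (ν i p : Measure I) = bernoulliMeasure 1 0 q

/-- Given the joint action `a`, the rewards of the players are drawn independently, that of
player `p` from the distribution of arm `a p` for player `p`. -/
noncomputable def rewardKernel (ν : Instance K M) : Kernel (Fin M → Fin K) (Fin M → I) :=
  Kernel.ofFunOfCountable fun a => Measure.pi fun p => (ν (a p) p : Measure I)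

instance (ν : Instance K M) : IsMarkovKernel (rewardKernel ν) :=
  ⟨fun a => by
    change IsProbabilityMeasure (Measure.pi fun p => (ν (a p) p : Measure I))
    infer_instance⟩

/-- Append the outcome of one more round to a history. -/
def extend (t : ℕ) (x : History K M t × Round K M) : History K M (t + 1) :=
  Fin.snoc (α := fun _ => Round K M) x.1 x.2

theorem measurable_extend (t : ℕ) : Measurable (extend (K := K) (M := M) t) := by
  refine measurable_pi_lambda _ fun j => ?_
  refine Fin.lastCases ?_ (fun j => ?_) j
  · simpa [extend] using measurable_snd
  · simpa [extend, Function.comp_def] using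
      (measurable_pi_apply (X := fun _ : Fin t => Round K M) j).comp
        (measurable_fst (β := Round K M))

/-- The number of pulls of arm `i` by player `p` in a history. -/
def pulls {t : ℕ} (i : Fin K) (p : Fin M) (h : History K M t) : ℕ :=
  (Finset.univ.filter fun s : Fin t => (h s).1 p = i).card

end Instance

namespace Algorithm

variable {K M T : ℕ}

/-- The conditional distribution of the outcome of round `t` given the history: the joint action
is drawn from the policy, then the rewards are drawn given the joint action. -/
noncomputable def roundKernel (A : Algorithm K M T) (ν : Instance K M) (t : ℕ) (ht : t < T) :
    Kernel (History K M t) (Round K M) :=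
  A.policy t ht ⊗ₖ Kernel.prodMkLeft (History K M t) (rewardKernel ν)

instance (A : Algorithm K M T) (ν : Instance K M) (t : ℕ) (ht : t < T) :
    IsMarkovKernel (A.roundKernel ν t ht) := by
  unfold roundKernel; infer_instance

/-- The law of the history of the first `t` rounds, when the algorithm runs on the instance. -/
noncomputable def law (A : Algorithm K M T) (ν : Instance K M) :
    (t : ℕ) → t ≤ T → Measure (History K M t)
  | 0, _ => Measure.dirac Fin.elim0
  | t + 1, ht => (A.law ν t (Nat.le_of_succ_le ht) ⊗ₘ A.roundKernel ν t ht).map (extend t)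

instance (A : Algorithm K M T) (ν : Instance K M) (t : ℕ) (ht : t ≤ T) :
    IsProbabilityMeasure (A.law ν t ht) := by
  induction t with
  | zero => unfold law; infer_instance
  | succ t ih =>
    unfold law
    have := ih (Nat.le_of_succ_le ht)
    exact Measure.isProbabilityMeasure_map (measurable_extend t).aemeasurable

/-- The expected number of pulls of arm `i` by player `p` in the `T` rounds. -/
noncomputable def expectedPulls (A : Algorithm K M T) (ν : Instance K M)
    (i : Fin K) (p : Fin M) : ℝ :=
  ∫ h, (pulls i p h : ℝ) ∂(A.law ν T le_rfl)

/-- The expected regret of player `p` after `T` rounds. -/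
noncomputable def playerRegret (A : Algorithm K M T) (ν : Instance K M) (p : Fin M) : ℝ :=
  ∑ i, gap ν i p * A.expectedPulls ν i p

/-- The expected collective regret of the players after `T` rounds. -/
noncomputable def regret (A : Algorithm K M T) (ν : Instance K M) : ℝ :=
  ∑ p, A.playerRegret ν p

end Algorithm

end MPMAB

/-! The bound is proved for each suboptimal pair (i, p) separately. Let Δ be its gap and N its
expected number of pulls. Raise the mean of arm i for player p alone by 2Δ, so that this arm becomes
best for p by at least Δ. Regret at most C T^(1-α) on both instances makes Δ (N + T - N') at most 2
C T^(1-α), where N' is the expected number of pulls on the new instance.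

Conversely, the two history laws differ only through the rewards p draws from arm i, however much
the players share. The relative entropy is thus N times that of two Bernoulli laws, hence at most 12
Δ² N (`bernoulli_kl_le`). The Bretagnolle–Huber inequality (`half_exp_integral_le`) gives N + T - N'
≥ (T/2) exp(-12 Δ² N), see `half_horizon_mul_exp_le`. Comparing the two bounds and taking logarithms
bounds N from below. -/

/-! ### Densities and relative entropy -/

/-- Changing one factor of a product measure by a density. -/
theorem MeasureTheory.Measure.pi_update_withDensity {ι : Type*} [Fintype ι] [DecidableEq ι]
    {X : ι → Type*} [∀ i, MeasurableSpace (X i)] (μ : ∀ i, Measure (X i))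
    [∀ i, IsFiniteMeasure (μ i)] (j : ι) {g : X j → ENNReal} (hg : Measurable g)
    [∀ i, SigmaFinite (Function.update μ j ((μ j).withDensity g) i)] :
    Measure.pi (Function.update μ j ((μ j).withDensity g))
      = (Measure.pi μ).withDensity fun x => g (x j) := by
  refine Measure.pi_eq fun s hs => ?_
  have hgj : Measurable fun x : ∀ i, X i => g (x j) := hg.comp (measurable_pi_apply j)
  rw [withDensity_apply _ (MeasurableSet.univ_pi hs), Measure.restrict_pi_pi,
    ← lintegral_map (f := g) hg (measurable_pi_apply j), Measure.pi_map_eval,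
    lintegral_smul_measure, ← withDensity_apply _ (hs j),
    ← Finset.prod_erase_mul _ _ (Finset.mem_univ j)]
  simp only [Function.update_self, smul_eq_mul, Measure.restrict_apply_univ]
  congr 1
  refine Finset.prod_congr rfl fun i hi => ?_
  rw [Function.update_of_ne (Finset.ne_of_mem_erase hi)]

/-- Pointwise form of Bretagnolle–Huber. With x = exp(d/2) and y = exp(s/2), the tangent bound exp u
≥ 1 + u makes the first term at most xy, and xy is at most both 1 + x²y²/4 and y² + x²/4. -/
theorem half_exp_le_min_one_exp (s d : ℝ) :
    Real.exp d * (1 + (s - d) / 2) - Real.exp d / 4 * (1 + Real.exp s) ≤ min 1 (Real.exp s) := by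
  set x := Real.exp (d / 2) with hx
  set y := Real.exp (s / 2) with hy
  have hxd : Real.exp d = x ^ 2 := by rw [hx, ← Real.exp_nat_mul]; congr 1; push_cast; ring
  have hys : Real.exp s = y ^ 2 := by rw [hy, ← Real.exp_nat_mul]; congr 1; push_cast; ring
  have hx0 : 0 < x := Real.exp_pos _
  have hy0 : 0 < y := Real.exp_pos _
  have hexp : x * (1 + (s - d) / 2) ≤ y := by
    have h : y = x * Real.exp ((s - d) / 2) := by rw [hx, hy, ← Real.exp_add]; congr 1; ring
    rw [h]
    gcongr
    linarith [Real.add_one_le_exp ((s - d) / 2)]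
  rw [hxd, hys]
  have h2 : x ^ 2 * (1 + (s - d) / 2) ≤ x * y := by nlinarith
  rw [le_min_iff]
  constructor
  · nlinarith [sq_nonneg (x * y / 2 - 1), sq_nonneg x]
  · nlinarith [sq_nonneg (y - x / 2), mul_nonneg (sq_nonneg x) (sq_nonneg y)]

/-- The Bretagnolle–Huber inequality, for a probability measure and its tilting by `exp ∘ S`. -/
theorem MeasureTheory.half_exp_integral_le {Ω : Type*} [MeasurableSpace Ω] (P : Measure Ω)
    [IsProbabilityMeasure P] {S : Ω → ℝ} (hS : Integrable S P)
    (hexp : Integrable (fun ω => Real.exp (S ω)) P) (hone : ∫ ω, Real.exp (S ω) ∂P = 1) :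
    Real.exp (∫ ω, S ω ∂P) / 2 ≤ ∫ ω, min 1 (Real.exp (S ω)) ∂P := by
  set d := ∫ ω, S ω ∂P with hd
  have h1 : Integrable (fun ω => Real.exp d * (1 + (S ω - d) / 2)) P := by fun_prop
  have h2 : Integrable (fun ω => Real.exp d / 4 * (1 + Real.exp (S ω))) P := by fun_prop
  -- As d is the mean of S, the linear term integrates to 0, leaving exp d - (exp d / 4) · 2.
  calc Real.exp d / 2
      = ∫ ω, (Real.exp d * (1 + (S ω - d) / 2) - Real.exp d / 4 * (1 + Real.exp (S ω))) ∂P := by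
        rw [integral_sub h1 h2, integral_const_mul, integral_const_mul,
          integral_add (by fun_prop) (by fun_prop), integral_add (by fun_prop) hexp, hone,
          integral_div, integral_sub hS (by fun_prop), ← hd]
        simp
        ring
    _ ≤ _ := integral_mono (h1.sub h2) ((integrable_const 1).inf hexp)
        fun ω => half_exp_le_min_one_exp _ _

/-- The relative entropy of two Bernoulli distributions with nearly fair parameters. -/
theorem bernoulli_kl_le {a δ : ℝ} (ha : a ∈ Set.Icc (15 / 32 : ℝ) (17 / 32)) (hδ : 0 < δ)
    (hδ' : δ ≤ 1 / 8) :
    -(3 * δ ^ 2) ≤ a * Real.log ((a + δ) / a)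
      + (1 - a) * Real.log ((1 - (a + δ)) / (1 - a)) := by
  obtain ⟨h1, h2⟩ := ha
  have ha0 : 0 < a := by linarith
  have hb0 : 0 < 1 - a := by linarith
  have e1 : (a + δ) / a = 1 + δ / a := by field_simp
  have e2 : (1 - (a + δ)) / (1 - a) = 1 - δ / (1 - a) := by field_simp; ring
  -- From log(1 + u) ≥ 2u/(u + 2); here 16/15 is 1/(2a) at a = 15/32.
  have k1 : δ - 16 / 15 * δ ^ 2 ≤ a * Real.log ((a + δ) / a) := by
    have h := Real.le_log_one_add_of_nonneg (x := δ / a) (by positivity)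
    rw [e1]
    refine le_trans ?_ (mul_le_mul_of_nonneg_left h ha0.le)
    have : a * (2 * (δ / a) / (δ / a + 2)) = 2 * a * δ / (δ + 2 * a) := by field_simp
    rw [this, le_div_iff₀ (by positivity)]
    nlinarith [pow_pos hδ 2, pow_pos hδ 3, mul_nonneg (pow_pos hδ 2).le (sub_nonneg.2 h1)]
  -- Second-order Taylor bound for log(1 - v). The constant 29/15 is what remains of 3 after 16/15.
  have k2 : -δ - 29 / 15 * δ ^ 2 ≤ (1 - a) * Real.log ((1 - (a + δ)) / (1 - a)) := by
    set v := δ / (1 - a) with hv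
    have hδv : δ = (1 - a) * v := by rw [hv]; field_simp
    have hv0 : 0 < v := by positivity
    have hv1 : v ≤ 4 / 15 := by rw [hv, div_le_iff₀ hb0]; linarith
    have h := Real.abs_log_sub_add_sum_range_le (x := v) (by rw [abs_of_pos hv0]; linarith) 2
    rw [abs_of_pos hv0] at h
    have h' := (abs_le.1 h).1
    simp only [Finset.sum_range_succ, Finset.sum_range_zero] at h'
    norm_num at h'
    have h3 : v ^ 3 / (1 - v) ≤ 4 / 11 * v ^ 2 := by
      rw [div_le_iff₀ (by linarith)]
      nlinarith [pow_pos hv0 2]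
    have h4 : -v - 19 / 22 * v ^ 2 ≤ Real.log (1 - v) := by linarith
    rw [e2]
    refine le_trans ?_ (mul_le_mul_of_nonneg_left h4 hb0.le)
    rw [hδv]
    have : 0 ≤ (1 - a) * v ^ 2 := by positivity
    nlinarith [mul_nonneg this (by linarith : 0 ≤ (1 - a) - 15 / 32)]
  nlinarith [sq_nonneg δ]

/-! ### Pull counts and the law of the history -/

namespace MPMAB
variable {K M T : ℕ}

theorem pulls_extend {t : ℕ} (i : Fin K) (p : Fin M) (h : History K M t) (r : Round K M) :
    pulls i p (extend t (h, r)) = pulls i p h + if r.1 p = i then 1 else 0 := by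
  simp only [pulls, Finset.card_filter, Fin.sum_univ_castSucc]
  simp [extend]

theorem sum_extend {t : ℕ} (φ : Round K M → ℝ) (h : History K M t) (r : Round K M) :
    ∑ s, φ (extend t (h, r) s) = ∑ s, φ (h s) + φ r := by
  simp [Fin.sum_univ_castSucc, extend]

theorem sum_pulls {t : ℕ} (p : Fin M) (h : History K M t) :
    ∑ i, pulls i p h = t := by
  simp only [pulls]
  rw [← Finset.card_eq_sum_card_fiberwise (t := Finset.univ) (f := fun s => (h s).1 p) (by simp)]
  simp

theorem pulls_eq_sum {t : ℕ} (i : Fin K) (p : Fin M) (h : History K M t) :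
    (pulls i p h : ℝ) = ∑ s, if (h s).1 p = i then (1 : ℝ) else 0 := by
  simp [pulls]

theorem pulls_le {t : ℕ} (i : Fin K) (p : Fin M) (h : History K M t) : pulls i p h ≤ t := by
  exact (Finset.card_filter_le _ _).trans (by simp)

theorem measurable_pulls {t : ℕ} (i : Fin K) (p : Fin M) :
    Measurable fun h : History K M t => (pulls i p h : ℝ) := by
  simp only [pulls_eq_sum]
  refine Finset.measurable_sum _ fun s _ => ?_
  have h1 : Measurable fun a : Fin M → Fin K => if a p = i then (1 : ℝ) else 0 :=
    measurable_of_countable _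
  exact h1.comp (measurable_fst.comp (measurable_pi_apply s))

theorem integrable_pulls {t : ℕ} (P : Measure (History K M t)) [IsProbabilityMeasure P]
    (i : Fin K) (p : Fin M) : Integrable (fun h => (pulls i p h : ℝ)) P := by
  refine Integrable.of_bound (measurable_pulls i p).aestronglyMeasurable t (ae_of_all _ fun h => ?_)
  simpa using pulls_le i p h

namespace Algorithm

theorem lintegral_roundKernel (A : Algorithm K M T) (ν : Instance K M) (t : ℕ) (ht : t < T)
    (h : History K M t) {f : Round K M → ENNReal} (hf : Measurable f) :
    ∫⁻ x, f x ∂(A.roundKernel ν t ht h)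
      = ∫⁻ a, ∫⁻ r, f (a, r) ∂(rewardKernel ν a) ∂(A.policy t ht h) := by
  rw [roundKernel, Kernel.lintegral_compProd _ _ _ hf]
  simp [Kernel.prodMkLeft_apply]

theorem lintegral_law_succ (A : Algorithm K M T) (ν : Instance K M) {t : ℕ} (ht : t + 1 ≤ T)
    {f : History K M (t + 1) → ENNReal} (hf : Measurable f) :
    ∫⁻ h, f h ∂(A.law ν (t + 1) ht)
      = ∫⁻ h, ∫⁻ a, ∫⁻ r, f (extend t (h, (a, r))) ∂(rewardKernel ν a) ∂(A.policy t ht h)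
          ∂(A.law ν t (Nat.le_of_succ_le ht)) := by
  have hfe := hf.comp (measurable_extend (K := K) (M := M) t)
  rw [law, lintegral_map hf (measurable_extend t),
    Measure.lintegral_compProd (f := fun x => f (extend t x)) hfe]
  exact lintegral_congr fun h => A.lintegral_roundKernel ν t ht h
    (f := fun x => f (extend t (h, x))) (hfe.comp measurable_prodMk_left)

/-- Change of measure: if the rewards of `ν'` have density `exp ∘ ψ` with respect to those of `ν`,
then the law of the history under `ν'` has as density the product of these densities. -/
theorem law_eq_withDensity (A : Algorithm K M T) {ν ν' : Instance K M} {ψ : Round K M → ℝ}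
    (hψ : Measurable ψ)
    (hν : ∀ a, rewardKernel ν' a
      = (rewardKernel ν a).withDensity fun r => ENNReal.ofReal (Real.exp (ψ (a, r))))
    (t : ℕ) (ht : t ≤ T) :
    A.law ν' t ht
      = (A.law ν t ht).withDensity fun h => ENNReal.ofReal (Real.exp (∑ s, ψ (h s))) := by
  induction t with
  | zero => simp [law]
  | succ t ih =>
    have hm (t : ℕ) : Measurable fun h : History K M t =>
        ENNReal.ofReal (Real.exp (∑ s, ψ (h s))) := by fun_prop
    -- Both laws use the same policy, so peeling off the last round leaves only the reward density
    -- as a new factor.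
    have key : ∀ f : History K M (t + 1) → ENNReal, Measurable f →
        ∫⁻ h, f h ∂(A.law ν' (t + 1) ht) = ∫⁻ h, f h ∂((A.law ν (t + 1) ht).withDensity
          fun h => ENNReal.ofReal (Real.exp (∑ s, ψ (h s)))) := by
      intro f hf
      rw [lintegral_withDensity_eq_lintegral_mul _ (hm _) hf, lintegral_law_succ A ν' ht hf,
        lintegral_law_succ A ν ht ((hm _).mul hf), ih]
      have hfe := hf.comp (measurable_extend (K := K) (M := M) t)
      have hma : Measurable fun h => ∫⁻ x, f (extend t (h, x)) ∂(A.roundKernel ν' t ht h) :=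
        Measurable.lintegral_kernel_prod_right hfe
      have heq (h : History K M t) : ∫⁻ x, f (extend t (h, x)) ∂(A.roundKernel ν' t ht h)
          = ∫⁻ a, ∫⁻ r, f (extend t (h, (a, r))) ∂(rewardKernel ν' a) ∂(A.policy t ht h) :=
        A.lintegral_roundKernel ν' t ht h (f := fun x => f (extend t (h, x)))
          (hfe.comp measurable_prodMk_left)
      simp only [heq] at hma
      rw [lintegral_withDensity_eq_lintegral_mul _ (hm _) hma]
      refine lintegral_congr fun h => ?_
      simp only [Pi.mul_apply]
      rw [← lintegral_const_mul _ (measurable_of_countable _)]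
      refine lintegral_congr fun a => ?_
      have hψa : Measurable fun r => ENNReal.ofReal (Real.exp (ψ (a, r))) := by fun_prop
      have hfa : Measurable fun r => f (extend t (h, (a, r))) :=
        hfe.comp (measurable_prodMk_left.comp measurable_prodMk_left)
      rw [hν, lintegral_withDensity_eq_lintegral_mul _ hψa hfa,
        ← lintegral_const_mul _ (hψa.mul hfa)]
      refine lintegral_congr fun r => ?_
      rw [sum_extend, Real.exp_add, ENNReal.ofReal_mul (Real.exp_nonneg _), mul_assoc]
      rfl
    ext s hs
    simpa [lintegral_indicator_one hs] using key (s.indicator 1) (measurable_one.indicator hs)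

/-- A sum of bounded increments with conditional mean zero has mean zero. -/
theorem integral_sum_eq_zero (A : Algorithm K M T) (ν : Instance K M) {φ : Round K M → ℝ}
    (hφ : Measurable φ) {B : ℝ} (hB : ∀ x, |φ x| ≤ B)
    (h0 : ∀ a, ∫ r, φ (a, r) ∂(rewardKernel ν a) = 0) (t : ℕ) (ht : t ≤ T) :
    ∫ h, ∑ s, φ (h s) ∂(A.law ν t ht) = 0 := by
  have hint (t : ℕ) (P : Measure (History K M t)) [IsProbabilityMeasure P] :
      Integrable (fun h => ∑ s, φ (h s)) P :=
    integrable_finsetSum _ fun s _ => Integrable.of_bound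
      (hφ.comp (measurable_pi_apply s)).aestronglyMeasurable B (ae_of_all _ fun h => hB _)
  have hφi (Q : Measure (Round K M)) [IsProbabilityMeasure Q] : Integrable φ Q :=
    Integrable.of_bound hφ.aestronglyMeasurable B (ae_of_all _ hB)
  induction t with
  | zero => simp
  | succ t ih =>
    have hprob : IsProbabilityMeasure
        ((A.law ν t (Nat.le_of_succ_le ht) ⊗ₘ A.roundKernel ν t ht).map (extend t)) :=
      Measure.isProbabilityMeasure_map (measurable_extend t).aemeasurable
    have hi := (integrable_map_measure (hint _ _).aestronglyMeasurable
      (measurable_extend t).aemeasurable).1 (hint (t + 1)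
        ((A.law ν t (Nat.le_of_succ_le ht) ⊗ₘ A.roundKernel ν t ht).map (extend t)))
    rw [law, integral_map (measurable_extend t).aemeasurable (hint _ _).aestronglyMeasurable,
      Measure.integral_compProd (f := fun x => ∑ s, φ (extend t x s)) hi, ← ih (Nat.le_of_succ_le ht)]
    refine integral_congr_ae (ae_of_all _ fun h => ?_)
    simp only [sum_extend]
    rw [integral_add (integrable_const _) (hφi _)]
    have : ∫ x, φ x ∂(A.roundKernel ν t ht h) = 0 := by
      have hr := hφi (A.roundKernel ν t ht h)
      rw [roundKernel] at hr ⊢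
      rw [ProbabilityTheory.integral_compProd hr]
      simp [Kernel.prodMkLeft_apply, h0]
    simp [this]

theorem expectedPulls_nonneg (A : Algorithm K M T) (ν : Instance K M) (i : Fin K) (p : Fin M) :
    0 ≤ A.expectedPulls ν i p :=
  integral_nonneg fun _ => Nat.cast_nonneg _

theorem sum_expectedPulls (A : Algorithm K M T) (ν : Instance K M) (p : Fin M) :
    ∑ i, A.expectedPulls ν i p = T := by
  simp only [expectedPulls]
  rw [← integral_finsetSum _ fun i _ => integrable_pulls _ i p]
  simp [← Nat.cast_sum, sum_pulls]

end Algorithm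

/-! ### Regret and pull counts -/

theorem mean_le_iSup (ν : Instance K M) (i : Fin K) (p : Fin M) :
    mean ν i p ≤ ⨆ j, mean ν j p :=
  le_ciSup (f := fun j => mean ν j p) (Set.finite_range _).bddAbove i

theorem gap_nonneg (ν : Instance K M) (i : Fin K) (p : Fin M) : 0 ≤ gap ν i p :=
  sub_nonneg.2 (mean_le_iSup ν i p)

namespace Algorithm

theorem playerRegret_nonneg (A : Algorithm K M T) (ν : Instance K M) (p : Fin M) :
    0 ≤ A.playerRegret ν p :=
  Finset.sum_nonneg fun i _ => mul_nonneg (gap_nonneg ν i p) (A.expectedPulls_nonneg ν i p)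

theorem playerRegret_le_regret (A : Algorithm K M T) (ν : Instance K M) (p : Fin M) :
    A.playerRegret ν p ≤ A.regret ν :=
  Finset.single_le_sum (fun q _ => A.playerRegret_nonneg ν q) (Finset.mem_univ p)

theorem gap_mul_expectedPulls_le (A : Algorithm K M T) (ν : Instance K M)
    (i : Fin K) (p : Fin M) : gap ν i p * A.expectedPulls ν i p ≤ A.regret ν :=
  (Finset.single_le_sum (f := fun i => gap ν i p * A.expectedPulls ν i p)
    (fun j _ => mul_nonneg (gap_nonneg ν j p) (A.expectedPulls_nonneg ν j p))
    (Finset.mem_univ i)).trans (A.playerRegret_le_regret ν p)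

/-- Player p pulls T times in all, so T minus the pulls of arm i counts pulls of other arms, each
costing at least δ. -/
theorem mul_sub_expectedPulls_le (A : Algorithm K M T) (ν : Instance K M) (i : Fin K) (p : Fin M)
    {δ : ℝ} (hδ : ∀ j ≠ i, δ ≤ gap ν j p) :
    δ * (T - A.expectedPulls ν i p) ≤ A.regret ν := by
  refine le_trans ?_ (A.playerRegret_le_regret ν p)
  rw [← A.sum_expectedPulls ν p, ← Finset.sum_erase_eq_sub (Finset.mem_univ i), Finset.mul_sum]
  refine (Finset.sum_le_sum fun j hj => mul_le_mul_of_nonneg_right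
    (hδ j (Finset.ne_of_mem_erase hj)) (A.expectedPulls_nonneg ν j p)).trans ?_
  exact Finset.sum_le_sum_of_subset_of_nonneg (Finset.erase_subset _ _) fun j _ _ =>
    mul_nonneg (gap_nonneg ν j p) (A.expectedPulls_nonneg ν j p)

end Algorithm
end MPMAB

/-! ### Bernoulli rewards and the change of one arm -/

theorem ProbabilityTheory.integral_bernoulli_one_zero (q : I) (f : I → ℝ) :
    ∫ x, f x ∂(bernoulliMeasure 1 0 q) = q * f 1 + (1 - q) * f 0 := by
  simp [integral_bernoulliMeasure]

theorem ProbabilityTheory.bernoulli_withDensity {a b : I} (ha : (a : ℝ) ∈ Set.Ioo 0 1)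
    (hb : (b : ℝ) ∈ Set.Ioo 0 1) :
    (bernoulliMeasure 1 0 a).withDensity (fun x : I => ENNReal.ofReal (Real.exp
        (if x = 1 then Real.log (b / a) else Real.log ((1 - b) / (1 - a)))))
      = bernoulliMeasure 1 0 b := by
  obtain ⟨ha0, ha1⟩ := ha
  obtain ⟨hb0, hb1⟩ := hb
  have hm : Measurable fun x : I => ENNReal.ofReal (Real.exp
      (if x = 1 then Real.log (b / a) else Real.log ((1 - b) / (1 - a)))) := by
    refine ENNReal.measurable_ofReal.comp (Real.measurable_exp.comp ?_)
    exact Measurable.ite (measurableSet_singleton 1) measurable_const measurable_const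
  have hcoe (q : I) : ((unitInterval.toNNReal q : NNReal) : ENNReal) = ENNReal.ofReal q := by
    rw [ENNReal.ofReal, ← unitInterval.coe_toNNReal q, Real.toNNReal_coe]
  ext s hs
  rw [withDensity_apply _ hs, ← lintegral_indicator hs]
  simp only [bernoulliMeasure_def, lintegral_add_measure, lintegral_smul_measure,
    lintegral_dirac, Measure.add_apply, Measure.smul_apply, Measure.dirac_apply' _ hs]
  have e1 : ENNReal.ofReal a * ENNReal.ofReal (b / a : ℝ) = ENNReal.ofReal b := by
    rw [← ENNReal.ofReal_mul ha0.le]; congr 1; field_simp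
  have e2 : ENNReal.ofReal (1 - a : ℝ) * ENNReal.ofReal ((1 - b) / (1 - a) : ℝ)
      = ENNReal.ofReal (1 - b) := by
    have : (0 : ℝ) < 1 - a := by linarith
    rw [← ENNReal.ofReal_mul this.le]; congr 1; field_simp
  have p1 : (0 : ℝ) < b / a := by positivity
  have p2 : (0 : ℝ) < (1 - b) / (1 - a) := div_pos (by linarith) (by linarith)
  congr 1
  · by_cases h : (1 : I) ∈ s
    · simp [h, ENNReal.smul_def, hcoe, Real.exp_log p1, e1]
    · simp [h]
  · by_cases h : (0 : I) ∈ s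
    · simp [h, ENNReal.smul_def, hcoe, Real.exp_log p2, e2]
    · simp [h]

namespace MPMAB
variable {K M T : ℕ}

theorem mean_eq_of_bernoulli {ν : Instance K M} {i : Fin K} {p : Fin M} {q : I}
    (h : (ν i p : Measure I) = bernoulliMeasure 1 0 q) : mean ν i p = q := by
  simp [mean, h, integral_bernoulli_one_zero]

/-- The instance in which the reward distribution of arm `i` for player `p` is replaced. -/
noncomputable def replaceArm (ν : Instance K M) (i : Fin K) (p : Fin M)
    (ρ : ProbabilityMeasure I) : Instance K M :=
  fun j q => if j = i ∧ q = p then ρ else ν j q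

theorem replaceArm_self (ν : Instance K M) (i : Fin K) (p : Fin M) (ρ : ProbabilityMeasure I) :
    replaceArm ν i p ρ i p = ρ := by
  simp [replaceArm]

theorem replaceArm_of_ne (ν : Instance K M) {i j : Fin K} (p : Fin M) (ρ : ProbabilityMeasure I)
    (hj : j ≠ i) : replaceArm ν i p ρ j p = ν j p := by
  simp [replaceArm, hj]

theorem mean_replaceArm_of_ne (ν : Instance K M) {i j : Fin K} (p : Fin M)
    (ρ : ProbabilityMeasure I) (hj : j ≠ i) : mean (replaceArm ν i p ρ) j p = mean ν j p := by
  simp [mean, replaceArm_of_ne ν p ρ hj]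

/-- Only the factor of player p can change, and only when p pulls arm i; otherwise the density is
exp 0 = 1. -/
theorem rewardKernel_replaceArm (ν : Instance K M) (i : Fin K) (p : Fin M)
    (ρ : ProbabilityMeasure I) {ℓ : I → ℝ} (hℓ : Measurable ℓ)
    (hρ : (ρ : Measure I)
      = (ν i p : Measure I).withDensity fun x => ENNReal.ofReal (Real.exp (ℓ x)))
    (a : Fin M → Fin K) :
    rewardKernel (replaceArm ν i p ρ) a = (rewardKernel ν a).withDensity fun r =>
      ENNReal.ofReal (Real.exp (if a p = i then ℓ (r p) else 0)) := by
  change Measure.pi (fun q => (replaceArm ν i p ρ (a q) q : Measure I))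
    = (Measure.pi fun q => (ν (a q) q : Measure I)).withDensity _
  by_cases h : a p = i
  · have hupd : (fun q => (replaceArm ν i p ρ (a q) q : Measure I))
        = Function.update (fun q => (ν (a q) q : Measure I)) p
          ((ν (a p) p : Measure I).withDensity fun x => ENNReal.ofReal (Real.exp (ℓ x))) := by
      ext1 q
      rcases eq_or_ne q p with rfl | hq
      · simp [replaceArm, h, hρ]
      · simp [replaceArm, hq]
    have hσ : ∀ q, SigmaFinite (Function.update (fun q => (ν (a q) q : Measure I)) p
          ((ν (a p) p : Measure I).withDensity fun x => ENNReal.ofReal (Real.exp (ℓ x))) q) := by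
      intro q
      rw [← hupd]
      infer_instance
    rw [hupd, Measure.pi_update_withDensity (fun q => (ν (a q) q : Measure I)) p
      (g := fun x => ENNReal.ofReal (Real.exp (ℓ x))) (by fun_prop)]
    simp [h]
  · have heq : (fun q => (replaceArm ν i p ρ (a q) q : Measure I))
        = fun q => (ν (a q) q : Measure I) := by
      ext1 q
      have : ¬(a q = i ∧ q = p) := by rintro ⟨h1, rfl⟩; exact h h1
      simp [replaceArm, this]
    simp [h, heq]

/-- An algorithm cannot both pull an arm rarely and pull it often after a change of its reward
distribution, unless it pulls it often enough to notice the change. -/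
theorem Algorithm.half_horizon_mul_exp_le (A : Algorithm K M T) (ν : Instance K M)
    (i : Fin K) (p : Fin M) (ρ : ProbabilityMeasure I) {ℓ : I → ℝ} (hℓ : Measurable ℓ)
    {B : ℝ} (hB : ∀ x, |ℓ x| ≤ B)
    (hρ : (ρ : Measure I)
      = (ν i p : Measure I).withDensity fun x => ENNReal.ofReal (Real.exp (ℓ x))) :
    T / 2 * Real.exp ((∫ x, ℓ x ∂(ν i p : Measure I)) * A.expectedPulls ν i p)
      ≤ A.expectedPulls ν i p + (T - A.expectedPulls (replaceArm ν i p ρ) i p) := by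
  set κ := ∫ x, ℓ x ∂(ν i p : Measure I) with hκ
  set P := A.law ν T le_rfl with hP
  have hB0 : 0 ≤ B := (abs_nonneg _).trans (hB 0)
  have hsel : MeasurableSet {x : Round K M | x.1 p = i} :=
    measurableSet_eq_fun ((measurable_pi_apply p).comp measurable_fst) measurable_const
  have hrew : Measurable fun x : Round K M => ℓ (x.2 p) :=
    hℓ.comp ((measurable_pi_apply p).comp measurable_snd)
  set ψ : Round K M → ℝ := fun x => if x.1 p = i then ℓ (x.2 p) else 0 with hψdef
  have hψ : Measurable ψ := Measurable.ite hsel hrew measurable_const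
  have hψB (x) : |ψ x| ≤ B := by
    simp only [hψdef]; split_ifs
    · exact hB _
    · simpa using hB0
  -- `S` is the log-likelihood ratio of the new instance to the old one.
  set S : History K M T → ℝ := fun h => ∑ s, ψ (h s) with hSdef
  have hSm : Measurable S :=
    Finset.measurable_sum _ fun s _ => hψ.comp (measurable_pi_apply s)
  have hSB (h) : |S h| ≤ T * B := by
    refine (Finset.abs_sum_le_sum_abs _ _).trans ?_
    simpa using Finset.sum_le_card_nsmul Finset.univ (fun s => |ψ (h s)|) B fun s _ => hψB _
  have hSi : Integrable S P := Integrable.of_bound hSm.aestronglyMeasurable _ (ae_of_all _ hSB)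
  have hEm : Measurable fun h => Real.exp (S h) := Real.measurable_exp.comp hSm
  have hEi : Integrable (fun h => Real.exp (S h)) P := by
    refine Integrable.of_bound hEm.aestronglyMeasurable (Real.exp (T * B)) (ae_of_all _ fun h => ?_)
    rw [Real.norm_eq_abs, Real.abs_exp]
    exact Real.exp_le_exp.2 ((le_abs_self _).trans (hSB h))
  have hlaw : A.law (replaceArm ν i p ρ) T le_rfl
      = P.withDensity fun h => ENNReal.ofReal (Real.exp (S h)) :=
    A.law_eq_withDensity hψ (rewardKernel_replaceArm ν i p ρ hℓ hρ) T le_rfl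
  have hchange (f : History K M T → ℝ) : ∫ h, f h ∂(A.law (replaceArm ν i p ρ) T le_rfl)
      = ∫ h, Real.exp (S h) * f h ∂P := by
    rw [hlaw, integral_withDensity_eq_integral_toReal_smul hEm.ennreal_ofReal (by simp)]
    simp [ENNReal.toReal_ofReal (Real.exp_nonneg _)]
  have hone : ∫ h, Real.exp (S h) ∂P = 1 := by
    have := hchange fun _ => 1
    simpa using this.symm
  -- Wald's identity: centring the increments by κ at each pull of arm i by p gives conditional mean
  -- zero.
  have hmeanS : ∫ h, S h ∂P = κ * A.expectedPulls ν i p := by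
    have h0 := A.integral_sum_eq_zero ν
      (φ := fun x => if x.1 p = i then ℓ (x.2 p) - κ else 0)
      (Measurable.ite hsel (hrew.sub_const κ) measurable_const) (B := B + |κ|)
      (fun x => by
        split_ifs
        · exact (abs_sub _ _).trans (by gcongr; exact hB _)
        · simpa using by positivity)
      (fun a => by
        by_cases ha : a p = i
        · simp only [ha, if_true]
          change ∫ r, (ℓ (r p) - κ) ∂(Measure.pi fun q => (ν (a q) q : Measure I)) = 0
          have hmp := measurePreserving_eval (fun q => (ν (a q) q : Measure I)) p
          have hmap := integral_map (μ := Measure.pi fun q => (ν (a q) q : Measure I))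
            (f := fun x => ℓ x - κ) hmp.measurable.aemeasurable
            (hℓ.sub_const κ).aestronglyMeasurable
          rw [hmp.map_eq, ha] at hmap
          refine hmap.symm.trans ?_
          rw [integral_sub (Integrable.of_bound hℓ.aestronglyMeasurable B (ae_of_all _ hB))
            (integrable_const _)]
          simp [hκ]
        · simp [ha]) T le_rfl
    have hsplit (h : History K M T) :
        (∑ s, if (h s).1 p = i then ℓ ((h s).2 p) - κ else 0) = S h - κ * pulls i p h := by
      rw [pulls_eq_sum, Finset.mul_sum, ← Finset.sum_sub_distrib]
      refine Finset.sum_congr rfl fun s _ => ?_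
      simp only [hψdef]; split_ifs <;> simp
    simp only [hsplit] at h0
    rw [integral_sub hSi ((integrable_pulls _ i p).const_mul κ), integral_const_mul] at h0
    rw [expectedPulls]
    linarith
  have hBH := half_exp_integral_le P hSi hEi hone
  rw [hmeanS] at hBH
  have hN := integrable_pulls P i p
  have hEN : Integrable (fun h => Real.exp (S h) * (T - pulls i p h : ℝ)) P := by
    refine (hEi.mul_const (T : ℝ)).mono'
      (hEm.mul (measurable_const.sub (measurable_pulls i p))).aestronglyMeasurable
      (ae_of_all _ fun h => ?_)
    have h1 : (pulls i p h : ℝ) ≤ T := by exact_mod_cast pulls_le i p h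
    rw [Real.norm_of_nonneg (mul_nonneg (Real.exp_nonneg _) (by linarith))]
    gcongr
    simp
  have hcompl : T - A.expectedPulls (replaceArm ν i p ρ) i p
      = ∫ h, Real.exp (S h) * (T - pulls i p h : ℝ) ∂P := by
    rw [← hchange, integral_sub (integrable_const _) (integrable_pulls _ i p)]
    simp [expectedPulls]
  calc T / 2 * Real.exp (κ * A.expectedPulls ν i p)
      = T * (Real.exp (κ * A.expectedPulls ν i p) / 2) := by ring
    _ ≤ T * ∫ h, min 1 (Real.exp (S h)) ∂P := by gcongr
    _ = ∫ h, T * min 1 (Real.exp (S h)) ∂P := (integral_const_mul _ _).symm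
    -- Split T into the pulls and the remaining rounds, both nonnegative; bound the minimum by 1 on
    -- the former and by exp S on the latter.
    _ ≤ ∫ h, ((pulls i p h : ℝ) + Real.exp (S h) * (T - pulls i p h : ℝ)) ∂P := by
        refine integral_mono (((integrable_const 1).inf hEi).const_mul _) (hN.add hEN) fun h => ?_
        have h1 : (pulls i p h : ℝ) ≤ T := by exact_mod_cast pulls_le i p h
        have h2 : (0 : ℝ) ≤ pulls i p h := Nat.cast_nonneg _
        have h3 := min_le_left 1 (Real.exp (S h))
        have h4 := min_le_right 1 (Real.exp (S h))
        simp only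
        nlinarith
    _ = _ := by rw [integral_add hN hEN, hcompl, expectedPulls]

/-- A uniformly good algorithm has to pull every suboptimal arm of an instance with nearly fair
Bernoulli rewards often. -/
theorem Algorithm.log_le_expectedPulls (hT : 0 < T) (A : Algorithm K M T) {C α : ℝ} (hC : 0 < C)
    (hA : ∀ ν : Instance K M, A.regret ν ≤ C * (T : ℝ) ^ (1 - α))
    {μ : Instance K M} (hBer : IsBernoulli μ)
    (hμ : ∀ i p, mean μ i p ∈ Set.Icc (15 / 32 : ℝ) (17 / 32))
    {i : Fin K} {p : Fin M} (hgap : 0 < gap μ i p) :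
    Real.log ((T : ℝ) ^ α * gap μ i p / (8 * C))
      ≤ 12 * gap μ i p ^ 2 * A.expectedPulls μ i p := by
  set Δ := gap μ i p with hΔ
  obtain ⟨a, ha⟩ := hBer i p
  have hma := mean_eq_of_bernoulli ha
  have haI := hμ i p
  rw [hma] at haI
  have hΔ' : Δ ≤ 1 / 16 := by
    have : Nonempty (Fin K) := ⟨i⟩
    have : ⨆ j, mean μ j p ≤ 17 / 32 := ciSup_le fun j => (hμ j p).2
    rw [hΔ, gap, hma]
    linarith [haI.1]
  -- The best old mean is a + Δ, so a + 2Δ beats every other arm by at least Δ.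
  have hb : (a : ℝ) + 2 * Δ ∈ Set.Ioo (0 : ℝ) 1 := ⟨by linarith [haI.1], by linarith [haI.2]⟩
  set b : I := ⟨a + 2 * Δ, hb.1.le, hb.2.le⟩ with hbdef
  set ρ : ProbabilityMeasure I := ⟨bernoulliMeasure 1 0 b, inferInstance⟩ with hρ
  set ν := replaceArm μ i p ρ with hν
  set ℓ : I → ℝ := fun x => if x = 1 then Real.log (b / a) else Real.log ((1 - b) / (1 - a))
    with hℓdef
  have hℓ : Measurable ℓ :=
    Measurable.ite (measurableSet_singleton 1) measurable_const measurable_const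
  have hℓB (x) : |ℓ x| ≤ |Real.log (b / a)| + |Real.log ((1 - b) / (1 - a))| := by
    simp only [hℓdef]
    split_ifs
    · exact le_add_of_nonneg_right (abs_nonneg _)
    · exact le_add_of_nonneg_left (abs_nonneg _)
  have hdens : (ρ : Measure I)
      = (μ i p : Measure I).withDensity fun x => ENNReal.ofReal (Real.exp (ℓ x)) := by
    rw [ha]
    exact (bernoulli_withDensity ⟨by linarith [haI.1], by linarith [haI.2]⟩ hb).symm
  have hmain := A.half_horizon_mul_exp_le μ i p ρ hℓ hℓB hdens
  -- 12 Δ² is 3 δ² at δ = 2Δ, and Δ ≤ 1/16 ensures δ ≤ 1/8.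
  have hκ : -(12 * Δ ^ 2) ≤ ∫ x, ℓ x ∂(μ i p : Measure I) := by
    have hkl := bernoulli_kl_le haI (δ := 2 * Δ) (by linarith) (by linarith)
    rw [ha, integral_bernoulli_one_zero]
    simp only [hℓdef, hbdef, if_true, zero_ne_one, if_false]
    linarith
  have hmν : mean ν i p = a + 2 * Δ := by
    rw [mean_eq_of_bernoulli (q := b) (by rw [hν, replaceArm_self]; rfl)]
  have hgapν : ∀ j ≠ i, Δ ≤ gap ν j p := by
    intro j hj
    have h1 := mean_le_iSup ν i p
    have h2 := mean_le_iSup μ j p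
    have h3 : Δ = (⨆ j, mean μ j p) - a := by rw [hΔ, gap, hma]
    rw [gap, hν, mean_replaceArm_of_ne μ p ρ hj, ← hν]
    linarith
  have hN := A.expectedPulls_nonneg μ i p
  have r1 := (A.gap_mul_expectedPulls_le μ i p).trans (hA μ)
  have r2 := (A.mul_sub_expectedPulls_le ν i p hgapν).trans (hA ν)
  have hT0 : (0 : ℝ) < T := by exact_mod_cast hT
  have hexp : Real.exp (-(12 * Δ ^ 2 * A.expectedPulls μ i p))
      ≤ Real.exp ((∫ x, ℓ x ∂(μ i p : Measure I)) * A.expectedPulls μ i p) := by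
    rw [Real.exp_le_exp, ← neg_mul]
    gcongr
  have hsum : Δ * (T / 2 * Real.exp (-(12 * Δ ^ 2 * A.expectedPulls μ i p)))
      ≤ 2 * C * (T : ℝ) ^ (1 - α) := by
    calc _ ≤ Δ * (A.expectedPulls μ i p + (T - A.expectedPulls ν i p)) := by
          gcongr
          exact le_trans (by gcongr) hmain
      _ ≤ _ := by linarith
  have hTα : (0 : ℝ) < (T : ℝ) ^ α := Real.rpow_pos_of_pos hT0 α
  rw [Real.rpow_sub hT0, Real.rpow_one, Real.exp_neg, ← div_eq_mul_inv] at hsum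
  have hE := Real.exp_pos (12 * Δ ^ 2 * A.expectedPulls μ i p)
  set E := Real.exp (12 * Δ ^ 2 * A.expectedPulls μ i p) with hEdef
  rw [Real.log_le_iff_le_exp (by positivity), ← hEdef, div_le_iff₀ (by positivity)]
  have h5 : Δ * (T / 2 / E) = T * (Δ / (2 * E)) := by field_simp
  have h6 : 2 * C * (T / (T : ℝ) ^ α) = T * (2 * C / (T : ℝ) ^ α) := by field_simp
  rw [h5, h6] at hsum
  have h7 := le_of_mul_le_mul_left hsum hT0
  rw [div_le_div_iff₀ (by positivity) hTα] at h7
  -- The argument gives 4C in the denominator; 8C is weaker.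
  nlinarith [mul_pos hC hE]

end MPMAB

theorem theorem5 (K M T : ℕ) (hT : 0 < T) (A : MPMAB.Algorithm K M T)
    (C α : ℝ) (hC : 0 < C) (hα : 0 < α)
    (hA : ∀ ν : MPMAB.Instance K M, A.regret ν ≤ C * (T : ℝ) ^ (1 - α))
    (μ : MPMAB.Instance K M) (hBer : MPMAB.IsBernoulli μ)
    (hμ : ∀ i p, MPMAB.mean μ i p ∈ Set.Icc (15 / 32 : ℝ) (17 / 32)) :
    ∑ i : Fin K, ∑ p : Fin M with 0 < MPMAB.gap μ i p,
        Real.log ((T : ℝ) ^ α * MPMAB.gap μ i p / (8 * C)) / (12 * MPMAB.gap μ i p)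
      ≤ A.regret μ := by
  unfold MPMAB.Algorithm.regret MPMAB.Algorithm.playerRegret
  rw [Finset.sum_comm (s := (Finset.univ : Finset (Fin M)))]
  refine Finset.sum_le_sum fun i _ => ?_
  refine le_trans (Finset.sum_le_sum fun p hp => ?_)
    (Finset.sum_le_sum_of_subset_of_nonneg (Finset.filter_subset _ _) fun p _ _ =>
      mul_nonneg (MPMAB.gap_nonneg μ i p) (A.expectedPulls_nonneg μ i p))
  have hgap := (Finset.mem_filter.1 hp).2
  rw [div_le_iff₀ (by positivity)]
  -- Clearing the denominator 12Δ turns the regret term Δ N into 12 Δ² N.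
  linarith [A.log_le_expectedPulls hT hC hA hBer hμ hgap]
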